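/- Let $\mathbb{H}^3=\{x_1+x_2\mathbf{i}+y\mathbf{j} : x_1,x_2\in\mathbb{R},\ y>0\}$ (a subset of the quaternions) with the left action of $\mathrm{SL}_2(\mathbb{C})$ by fractional linear transformations $gz=(az+b)(cz+d)^{-1}$. Put $\phi_1(z)=-\log y$, $\phi_2(z)=x_1$, $\phi_3(z)=x_2$ and $\phi_{[2,3]}=(\phi_2,\phi_3):\mathbb{H}^3\to\mathbb{R}^2$. Let $\mathbf{c}:\mathrm{SL}_2(\mathbb{C})\to\mathrm{SO}_3(\mathbb{C})$ be the morphism sending $g$ to the matrix of $X\mapsto gXg^{-1}$ on $\mathfrak{sl}_2(\mathbb{C})$ in the basis $X_1=\begin{pmatrix}0&1\\1&0\end{pmatrix}$, $X_2=\begin{pmatrix}0&\mathbf{i}\\-\mathbf{i}&0\end{pmatrix}$, $Y=\begin{pmatrix}1&0\\0&-1\end{pmatrix}$, which is orthonormal for the form $\frac12\mathrm{Tr}(XX')$. Let $\Gamma=\mathbf{c}^{-1}(\mathrm{SO}_3(\mathbb{Z}[\mathbf{i}]))\subset\mathrm{SL}_2(\mathbb{C})$, and let $\Gamma^{\phi_1}=\{\gamma\in\Gamma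 : \phi_1(\gamma z)=\phi_1(z)\text{ for all }z\in\mathbb{H}^3\}$. For $\gamma\in\Gamma^{\phi_1}$ the functions $\phi_2\circ\gamma,\phi_3\circ\gamma$ do not depend on the first coordinate, so $\Gamma^{\phi_1}$ acts on $\mathbb{R}^2$ by $\gamma\cdot t=\phi_{[2,3]}(\gamma(t_1+t_2\mathbf{i}+\mathbf{j}))$; the element $-1$ acts trivially on $\mathbb{H}^3$ and on $\mathbb{R}^2$. For a group $\Delta$ acting on a topological space $X$, a subset $F\subseteq X$ is called a *fundamental domain* if $\Delta F=X$ and, for all $\delta_1\ne\delta_2$ in $\Delta$, $\delta_1F\cap\delta_2F\subseteq\delta_1\partial F\cap\delta_2\partial F$. **Theorem.** Let $\mathcal{G}\subseteq\mathbb{R}^2$ be a fundamental domain for the induced action of $\Gamma^{\phi_1}/\{\pm1\}$ on $\mathbb{R}^2$, and assume $\mathcal{G}=\overline{\mathrm{int}(\mathcal{G})}$. Define $$\mathcal{F}_1=\{z\in\mathbb{H}^3 : \phi_1(z)\le\phi_1(\gamma z)\text{ for all }\gamma\in\Gamma\},\qquad \mathcal{F}(\mathcal{G})=\phi_{[2,3]}^{-1}(\mathcal{G})\cap\mathcal{F}_1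 .$$ Then: (a) $\mathcal{F}(\mathcal{G})$ is a fundamental domain for the action of $\Gamma/\{\pm1\}$ on $\mathbb{H}^3$. (b) $\mathcal{F}(\mathcal{G})=\overline{\mathrm{int}(\mathcal{F}(\mathcal{G}))}$. (c) $\mathrm{int}(\mathcal{F}_1)=\{z\in\mathbb{H}^3 : \phi_1(z)<\phi_1(\gamma z)\text{ for all }\gamma\in\Gamma-\Gamma^{\phi_1}\}$ and $\mathrm{int}(\mathcal{F}(\mathcal{G}))=\phi_{[2,3]}^{-1}(\mathrm{int}(\mathcal{G}))\cap\mathrm{int}(\mathcal{F}_1)$. -/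

import Mathlib

open scoped Pointwise Quaternion MatrixGroups

namespace GrenierDomain

/-! ### Fundamental domains -/

/-- An (exact) fundamental domain for a group `G` acting on a topological space `X`: the translates
of `F` cover `X`, and distinct translates of `F` meet only on their boundaries. -/
structure IsFundDomain (G : Type*) {X : Type*} [Group G] [TopologicalSpace X] [MulAction G X]
    (F : Set X) : Prop where
  cover : ⋃ g : G, g • F = Set.univ
  inter : ∀ g₁ g₂ : G, g₁ ≠ g₂ →
    (g₁ • F) ∩ (g₂ • F) ⊆ (g₁ • frontier F) ∩ (g₂ • frontier F)

/-- If a normal subgroup `N` acts trivially on `X`, the action of `G` descends to `G ⧸ N`. -/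
@[reducible]
def quotientAction {G X : Type*} [Group G] [MulAction G X] (N : Subgroup G) [N.Normal]
    (hN : ∀ n ∈ N, ∀ x : X, n • x = x) : MulAction (G ⧸ N) X :=
  MulAction.compHom X (QuotientGroup.lift N (MulAction.toPermHom G X)
    (fun n hn => Equiv.ext (fun x => hN n hn x)))

/-! ### Hyperbolic three-space in the quaternion model -/

/-- `SL₂(ℂ)`. -/
abbrev SL2C : Type := Matrix.SpecialLinearGroup (Fin 2) ℂ

/-- Upper half-space: the quaternions `x₁ + x₂ i + y j` with `y > 0`, with the subspace topology. -/
abbrev H3 : Type := {q : ℍ[ℝ] // 0 < q.imJ ∧ q.imK = 0}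

/-- The numerator `a z + b` of the fractional linear transformation, as a quaternion. -/
noncomputable def num (g : SL2C) (q : ℍ[ℝ]) : ℍ[ℝ] :=
  Quaternion.coeComplex (g 0 0) * q + Quaternion.coeComplex (g 0 1)

/-- The denominator `c z + d` of the fractional linear transformation, as a quaternion. -/
noncomputable def den (g : SL2C) (q : ℍ[ℝ]) : ℍ[ℝ] :=
  Quaternion.coeComplex (g 1 0) * q + Quaternion.coeComplex (g 1 1)

lemma sl2_det (g : SL2C) : g 0 0 * g 1 1 - g 0 1 * g 1 0 = 1 := by
  have h := g.det_coe
  rwa [Matrix.det_fin_two] at h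

lemma den_ne_zero (g : SL2C) (z : H3) : den g z.1 ≠ 0 := by
  obtain ⟨q, hy, hk⟩ := z
  intro h
  have hJ : (den g q).imJ = 0 := by rw [h]; rfl
  have hK : (den g q).imK = 0 := by rw [h]; rfl
  have hR : (den g q).re = 0 := by rw [h]; rfl
  have hI : (den g q).imI = 0 := by rw [h]; rfl
  simp [den, hk] at hJ hK hR hI
  have hc1 : (g 1 0).re = 0 := hJ.resolve_right hy.ne'
  have hc2 : (g 1 0).im = 0 := hK.resolve_right hy.ne'
  have hc : g 1 0 = 0 := Complex.ext hc1 hc2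
  simp [hc1, hc2] at hR hI
  have hd : g 1 1 = 0 := Complex.ext hR hI
  have := sl2_det g
  simp [hc, hd] at this

/-- The fractional linear transformation `z ↦ (a z + b) (c z + d)⁻¹` on quaternions. -/
noncomputable def flt (g : SL2C) (q : ℍ[ℝ]) : ℍ[ℝ] := num g q * (den g q)⁻¹

lemma flt_mem (g : SL2C) (z : H3) : 0 < (flt g z.1).imJ ∧ (flt g z.1).imK = 0 := by
  have hden := den_ne_zero g z
  have hpos : 0 < Quaternion.normSq (den g z.1) :=
    lt_of_le_of_ne Quaternion.normSq_nonneg (Quaternion.normSq_ne_zero.mpr hden).symm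
  obtain ⟨q, hy, hk⟩ := z
  have hdet := sl2_det g
  have h1 := congrArg Complex.re hdet
  have h2 := congrArg Complex.im hdet
  simp at h1 h2
  have hinv : flt g q = (Quaternion.normSq (den g q))⁻¹ • (num g q * star (den g q)) := by
    rw [flt, Quaternion.inv_def, mul_smul_comm]
  have hJ : (num g q * star (den g q)).imJ = q.imJ := by
    simp [num, den, hk]
    linear_combination q.imJ * h1
  have hK : (num g q * star (den g q)).imK = 0 := by
    simp [num, den, hk]
    linear_combination q.imJ * h2
  constructor
  · rw [hinv, Quaternion.imJ_smul, hJ]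
    exact mul_pos (inv_pos.mpr hpos) hy
  · rw [hinv, Quaternion.imK_smul, hK, smul_zero]

lemma num_one (q : ℍ[ℝ]) : num 1 q = q := by simp [num]

lemma den_one (q : ℍ[ℝ]) : den 1 q = 1 := by simp [den]

lemma num_mul (g h : SL2C) (z : H3) : num (g * h) z.1 = num g (flt h z.1) * den h z.1 := by
  have hd := den_ne_zero h z
  have e1 : num g (flt h z.1) * den h z.1
      = Quaternion.coeComplex (g 0 0) * num h z.1 + Quaternion.coeComplex (g 0 1) * den h z.1 := by
    rw [num, flt, add_mul, mul_assoc, mul_assoc, inv_mul_cancel₀ hd, mul_one]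
  rw [e1]
  simp only [num, den, Matrix.SpecialLinearGroup.coe_mul, Matrix.mul_apply, Fin.sum_univ_two,
    Quaternion.coeComplex_add, Quaternion.coeComplex_mul]
  noncomm_ring

lemma den_mul (g h : SL2C) (z : H3) : den (g * h) z.1 = den g (flt h z.1) * den h z.1 := by
  have hd := den_ne_zero h z
  have e1 : den g (flt h z.1) * den h z.1
      = Quaternion.coeComplex (g 1 0) * num h z.1 + Quaternion.coeComplex (g 1 1) * den h z.1 := by
    rw [den, flt, add_mul, mul_assoc, mul_assoc, inv_mul_cancel₀ hd, mul_one]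
  rw [e1]
  simp only [num, den, Matrix.SpecialLinearGroup.coe_mul, Matrix.mul_apply, Fin.sum_univ_two,
    Quaternion.coeComplex_add, Quaternion.coeComplex_mul]
  noncomm_ring

/-- `SL₂(ℂ)` acts on upper half-space on the left by fractional linear transformations. -/
noncomputable instance : MulAction SL2C H3 where
  smul g z := ⟨flt g z.1, flt_mem g z⟩
  one_smul z := Subtype.ext (by
    change flt 1 z.1 = z.1
    rw [flt, num_one, den_one, inv_one, mul_one])
  mul_smul g h z := Subtype.ext (by
    change flt (g * h) z.1 = flt g (flt h z.1)
    have hd := den_ne_zero h z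
    rw [flt, num_mul, den_mul, mul_inv_rev, mul_assoc, mul_inv_cancel_left₀ hd, ← flt])

lemma smul_val (g : SL2C) (z : H3) : (g • z).1 = flt g z.1 := rfl

/-! ### Coordinates -/

/-- `φ₁ = - log y`. -/
noncomputable def phi1 (z : H3) : ℝ := -Real.log z.1.imJ

/-- `φ₂ = x₁`. -/
def phi2 (z : H3) : ℝ := z.1.re

/-- `φ₃ = x₂`. -/
def phi3 (z : H3) : ℝ := z.1.imI

/-- The projection `φ_{[2,3]}`. -/
def phi23 (z : H3) : ℝ × ℝ := (phi2 z, phi3 z)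

/-- The zero section of `φ_{[2,3]}`: the point with coordinates `(φ₁, φ₂, φ₃) = (0, t₁, t₂)`,
that is `t₁ + t₂ i + j`. -/
def sigma23 (t : ℝ × ℝ) : H3 := ⟨⟨t.1, t.2, 1, 0⟩, one_pos, rfl⟩

/-- `Γ^{φ₁}`: the elements of `Γ` whose action preserves the first coordinate. -/
def stab1 (Γ : Subgroup SL2C) : Subgroup SL2C where
  carrier := {γ | γ ∈ Γ ∧ ∀ z : H3, phi1 (γ • z) = phi1 z}
  one_mem' := ⟨Γ.one_mem, fun z => by rw [one_smul]⟩
  mul_mem' := fun {a b} ha hb => ⟨Γ.mul_mem ha.1 hb.1, fun z => by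
    rw [mul_smul, ha.2, hb.2]⟩
  inv_mem' := fun {a} ha => ⟨Γ.inv_mem ha.1, fun z => by
    rw [← ha.2 (a⁻¹ • z), smul_inv_smul]⟩

/-! ### The action induced on the last two coordinates -/

lemma imJ_smul (g : SL2C) (z : H3) :
    (g • z).1.imJ = z.1.imJ / Quaternion.normSq (den g z.1) := by
  obtain ⟨q, hy, hk⟩ := z
  have h1 := congrArg Complex.re (sl2_det g)
  simp at h1
  have hJ : (num g q * star (den g q)).imJ = q.imJ := by
    simp [num, den, hk]
    linear_combination q.imJ * h1
  rw [smul_val, flt, Quaternion.inv_def, mul_smul_comm, Quaternion.imJ_smul, hJ, smul_eq_mul,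
    div_eq_inv_mul]

lemma normSq_den_of_mem {Γ : Subgroup SL2C} {γ : SL2C} (hγ : γ ∈ stab1 Γ) (z : H3) :
    Quaternion.normSq (den γ z.1) = 1 := by
  have h := hγ.2 z
  have h0 : (γ • z).1.imJ = z.1.imJ :=
    Real.log_injOn_pos (γ • z).2.1 z.2.1 (neg_injective h)
  have hne : Quaternion.normSq (den γ z.1) ≠ 0 := Quaternion.normSq_ne_zero.mpr (den_ne_zero γ z)
  rw [imJ_smul, div_eq_iff hne] at h0
  have hy : z.1.imJ ≠ 0 := z.2.1.ne'
  exact (mul_left_cancel₀ hy (by rw [mul_one]; exact h0)).symm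

lemma lower_left_of_mem {Γ : Subgroup SL2C} {γ : SL2C} (hγ : γ ∈ stab1 Γ) : γ 1 0 = 0 := by
  have key : ∀ z : H3, z.1.re = 0 → z.1.imI = 0 →
      ((γ 1 0).re ^ 2 + (γ 1 0).im ^ 2) * z.1.imJ ^ 2 + (γ 1 1).re ^ 2 + (γ 1 1).im ^ 2 = 1 := by
    intro z h1 h2
    have e := normSq_den_of_mem hγ z
    have hk := z.2.2
    simp [Quaternion.normSq_def', den, h1, h2, hk] at e
    linear_combination e
  have e1 := key ⟨⟨0, 0, 1, 0⟩, one_pos, rfl⟩ rfl rfl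
  have e2 := key ⟨⟨0, 0, 2, 0⟩, two_pos, rfl⟩ rfl rfl
  simp only at e1 e2
  have hre : (γ 1 0).re = 0 := by nlinarith [sq_nonneg (γ 1 0).re, sq_nonneg (γ 1 0).im]
  have him : (γ 1 0).im = 0 := by nlinarith [sq_nonneg (γ 1 0).re, sq_nonneg (γ 1 0).im]
  exact Complex.ext hre him

/-- For `γ ∈ Γ^{φ₁}` the functions `φ₂ ∘ γ`, `φ₃ ∘ γ` do not depend on the first coordinate. -/
lemma phi23_smul_congr {Γ : Subgroup SL2C} {γ : SL2C} (hγ : γ ∈ stab1 Γ) {z w : H3}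
    (h : phi23 z = phi23 w) : phi23 (γ • z) = phi23 (γ • w) := by
  have hc := lower_left_of_mem hγ
  have h1 : z.1.re = w.1.re := congrArg Prod.fst h
  have h2 : z.1.imI = w.1.imI := congrArg Prod.snd h
  have hk1 := z.2.2
  have hk2 := w.2.2
  have hd : den γ z.1 = den γ w.1 := by simp [den, hc]
  have hd' : den γ w.1 = Quaternion.coeComplex (γ 1 1) := by simp [den, hc]
  apply Prod.ext
  · change (flt γ z.1).re = (flt γ w.1).re
    rw [flt, flt, hd, hd', Quaternion.inv_def]
    simp [num, h1, h2, hk1, hk2]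
  · change (flt γ z.1).imI = (flt γ w.1).imI
    rw [flt, flt, hd, hd', Quaternion.inv_def]
    simp [num, h1, h2, hk1, hk2]

lemma phi23_sigma23 (t : ℝ × ℝ) : phi23 (sigma23 t) = t := rfl

/-- The action of `Γ^{φ₁}` on `ℝ²` induced by the action on upper half-space:
`γ • t = φ_{[2,3]} (γ • σ(t))` with `σ` the zero section. -/
noncomputable instance (Γ : Subgroup SL2C) : MulAction (stab1 Γ) (ℝ × ℝ) where
  smul γ t := phi23 ((γ : SL2C) • sigma23 t)
  one_smul t := by
    change phi23 ((1 : SL2C) • sigma23 t) = t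
    rw [one_smul, phi23_sigma23]
  mul_smul γ δ t := by
    change phi23 (((γ : SL2C) * (δ : SL2C)) • sigma23 t)
      = phi23 ((γ : SL2C) • sigma23 (phi23 ((δ : SL2C) • sigma23 t)))
    rw [mul_smul]
    exact phi23_smul_congr γ.2 (phi23_sigma23 _).symm

lemma stab1_smul_def (Γ : Subgroup SL2C) (γ : stab1 Γ) (t : ℝ × ℝ) :
    γ • t = phi23 ((γ : SL2C) • sigma23 t) := rfl

/-! ### Dividing out by `±1` -/

/-- The subgroup `{±1}` of `SL₂(ℂ)`. -/
def pmOne : Subgroup SL2C where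
  carrier := {1, -1}
  one_mem' := Or.inl rfl
  mul_mem' := by
    rintro a b (rfl | rfl) (rfl | rfl) <;> simp
  inv_mem' := by
    rintro a (rfl | rfl) <;> simp

lemma mem_pmOne {g : SL2C} : g ∈ pmOne ↔ g = 1 ∨ g = -1 := Iff.rfl

instance : pmOne.Normal where
  conj_mem := by
    rintro n (rfl | rfl) g
    · exact Or.inl (by simp)
    · exact Or.inr (by simp)

lemma neg_one_smul_H3 (z : H3) : (-1 : SL2C) • z = z := by
  apply Subtype.ext
  rw [smul_val]
  have h1 : num (-1) z.1 = -z.1 := by ext <;> simp [num]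
  have h2 : den (-1) z.1 = -1 := by ext <;> simp [den]
  rw [flt, h1, h2, inv_neg, inv_one, neg_mul_neg, mul_one]

lemma pmOne_smul {n : SL2C} (hn : n ∈ pmOne) (z : H3) : n • z = z := by
  rcases hn with rfl | rfl
  · exact one_smul _ z
  · exact neg_one_smul_H3 z

/-- `Γ/{±1}`. -/
abbrev ModPM (Γ : Subgroup SL2C) : Type := Γ ⧸ pmOne.subgroupOf Γ

/-- The action of `Γ/{±1}` on upper half-space. -/
noncomputable instance (Γ : Subgroup SL2C) : MulAction (ModPM Γ) H3 :=
  quotientAction (pmOne.subgroupOf Γ) (fun _ hn z => pmOne_smul hn z)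

/-- The action of `Γ^{φ₁}/{±1}` on `ℝ²`. -/
noncomputable instance (Γ : Subgroup SL2C) : MulAction (ModPM (stab1 Γ)) (ℝ × ℝ) :=
  quotientAction (pmOne.subgroupOf (stab1 Γ)) (fun n hn t => by
    exact congrArg phi23 (pmOne_smul hn (sigma23 t)))

lemma mk_smul_H3 (Γ : Subgroup SL2C) (γ : Γ) (z : H3) :
    (QuotientGroup.mk γ : ModPM Γ) • z = (γ : SL2C) • z := rfl

lemma mk_smul_prod (Γ : Subgroup SL2C) (γ : stab1 Γ) (t : ℝ × ℝ) :
    (QuotientGroup.mk γ : ModPM (stab1 Γ)) • t = phi23 ((γ : SL2C) • sigma23 t) := rfl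

/-! ### The group `Γ = conj⁻¹(SO₃(ℤ[i]))` -/

/-- The basis `X₁ = (0 1; 1 0)`, `X₂ = i (0 1; -1 0)`, `Y = (1 0; 0 -1)` of the traceless matrices,
orthonormal for the half-trace form. -/
def basisSl2 : Fin 3 → Matrix (Fin 2) (Fin 2) ℂ :=
  ![!![0, 1; 1, 0], !![0, Complex.I; -Complex.I, 0], !![1, 0; 0, -1]]

/-- The half-trace form `B(X, Y) = Tr(X Y) / 2`. -/
noncomputable def halfTrace (X Y : Matrix (Fin 2) (Fin 2) ℂ) : ℂ := (X * Y).trace / 2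

lemma halfTrace_basis (i j : Fin 3) :
    halfTrace (basisSl2 i) (basisSl2 j) = if i = j then 1 else 0 := by
  fin_cases i <;> fin_cases j <;> simp [halfTrace, basisSl2, Matrix.trace_fin_two]

/-- A traceless matrix is the combination of the basis with coefficients given by the form. -/
lemma eq_sum_basis (X : Matrix (Fin 2) (Fin 2) ℂ) (hX : X.trace = 0) :
    X = ∑ i, halfTrace (basisSl2 i) X • basisSl2 i := by
  rw [Matrix.trace_fin_two] at hX
  have hI := Complex.I_mul_I
  ext i j
  fin_cases i <;> fin_cases j <;>
    simp [Fin.sum_univ_three, halfTrace, basisSl2, Matrix.trace_fin_two, Matrix.mul_apply,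
      Fin.sum_univ_two]
  · linear_combination hX / 2
  · linear_combination ((X 0 1 - X 1 0) / 2) * hI
  · linear_combination ((X 1 0 - X 0 1) / 2) * hI
  · linear_combination hX / 2

/-- The matrix, in the basis above, of the conjugation `X ↦ g X g⁻¹` on traceless matrices. -/
noncomputable def conjMatrix (g : SL2C) : Matrix (Fin 3) (Fin 3) ℂ :=
  Matrix.of fun i j => halfTrace (basisSl2 i)
    ((g : Matrix (Fin 2) (Fin 2) ℂ) * basisSl2 j * ((g⁻¹ : SL2C) : Matrix (Fin 2) (Fin 2) ℂ))

/-- `conjMatrix g` is indeed the matrix of conjugation by `g`. -/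
lemma conj_basis (g : SL2C) (j : Fin 3) :
    (g : Matrix (Fin 2) (Fin 2) ℂ) * basisSl2 j * ((g⁻¹ : SL2C) : Matrix (Fin 2) (Fin 2) ℂ)
      = ∑ i, conjMatrix g i j • basisSl2 i := by
  apply eq_sum_basis
  rw [Matrix.trace_mul_comm, ← mul_assoc, ← Matrix.SpecialLinearGroup.coe_mul, inv_mul_cancel,
    Matrix.SpecialLinearGroup.coe_one, one_mul]
  fin_cases j <;> simp [basisSl2, Matrix.trace_fin_two]

/-- The explicit form of `conjMatrix`. -/
lemma conjMatrix_eq (g : SL2C) : conjMatrix g =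
    !![((g 0 0)^2 - (g 1 0)^2 + (g 1 1)^2 - (g 0 1)^2) / 2,
        Complex.I * ((g 0 0)^2 - (g 1 0)^2 + (g 0 1)^2 - (g 1 1)^2) / 2,
        g 1 0 * g 1 1 - g 0 0 * g 0 1;
      Complex.I * ((g 0 1)^2 + (g 1 1)^2 - (g 0 0)^2 - (g 1 0)^2) / 2,
        ((g 0 0)^2 + (g 1 0)^2 + (g 0 1)^2 + (g 1 1)^2) / 2,
        Complex.I * (g 0 0 * g 0 1 + g 1 0 * g 1 1);
      -(g 0 0 * g 1 0) + g 0 1 * g 1 1,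
        -(Complex.I * (g 0 0 * g 1 0 + g 0 1 * g 1 1)),
        g 0 0 * g 1 1 + g 0 1 * g 1 0] := by
  have hI := Complex.I_sq
  ext i j
  fin_cases i <;> fin_cases j <;>
    simp [conjMatrix, halfTrace, basisSl2, Matrix.trace_fin_two, Matrix.mul_apply,
      Fin.sum_univ_two, Matrix.SpecialLinearGroup.coe_inv, Matrix.adjugate_fin_two] <;>
    (try ring_nf) <;> (try simp only [hI]) <;> (try ring_nf)

lemma trace_conj (g : SL2C) (X : Matrix (Fin 2) (Fin 2) ℂ) :
    ((g : Matrix (Fin 2) (Fin 2) ℂ) * X * ((g⁻¹ : SL2C) : Matrix (Fin 2) (Fin 2) ℂ)).trace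
      = X.trace := by
  rw [Matrix.trace_mul_comm, ← mul_assoc, ← Matrix.SpecialLinearGroup.coe_mul, inv_mul_cancel,
    Matrix.SpecialLinearGroup.coe_one, one_mul]

lemma conjMatrix_one : conjMatrix 1 = 1 := by
  ext i j
  simp [conjMatrix, halfTrace_basis, Matrix.one_apply]

lemma conjMatrix_mul (g h : SL2C) : conjMatrix (g * h) = conjMatrix g * conjMatrix h := by
  ext i j
  have e : ((g * h : SL2C) : Matrix (Fin 2) (Fin 2) ℂ) * basisSl2 j
        * (((g * h)⁻¹ : SL2C) : Matrix (Fin 2) (Fin 2) ℂ)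
      = ∑ k, conjMatrix h k j • ((g : Matrix (Fin 2) (Fin 2) ℂ) * basisSl2 k
        * ((g⁻¹ : SL2C) : Matrix (Fin 2) (Fin 2) ℂ)) := by
    calc _ = (g : Matrix (Fin 2) (Fin 2) ℂ) * ((h : Matrix (Fin 2) (Fin 2) ℂ) * basisSl2 j
          * ((h⁻¹ : SL2C) : Matrix (Fin 2) (Fin 2) ℂ))
          * ((g⁻¹ : SL2C) : Matrix (Fin 2) (Fin 2) ℂ) := by
            rw [mul_inv_rev, Matrix.SpecialLinearGroup.coe_mul, Matrix.SpecialLinearGroup.coe_mul]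
            simp only [mul_assoc]
      _ = _ := by
            rw [conj_basis h j, Finset.mul_sum, Finset.sum_mul]
            simp only [mul_smul_comm, smul_mul_assoc]
  rw [Matrix.mul_apply]
  simp only [conjMatrix, Matrix.of_apply] at e ⊢
  rw [e, halfTrace, Finset.mul_sum, Matrix.trace_sum, Finset.sum_div]
  refine Finset.sum_congr rfl fun k _ => ?_
  rw [mul_smul_comm, Matrix.trace_smul, smul_eq_mul, mul_div_assoc, mul_comm]
  rfl

/-- Inversion becomes transposition: conjugation preserves the half-trace form. -/
lemma conjMatrix_inv (g : SL2C) : conjMatrix g⁻¹ = (conjMatrix g).transpose := by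
  ext i j
  simp only [conjMatrix, Matrix.of_apply, Matrix.transpose_apply, halfTrace, inv_inv]
  congr 1
  rw [← mul_assoc, Matrix.trace_mul_comm, ← mul_assoc, ← mul_assoc, Matrix.trace_mul_comm]

/-- The morphism `conj` from `SL₂(ℂ)` to `3 × 3` matrices. -/
noncomputable def conj : SL2C →* Matrix (Fin 3) (Fin 3) ℂ where
  toFun := conjMatrix
  map_one' := conjMatrix_one
  map_mul' := conjMatrix_mul

/-- The morphism `conj` takes its values in `SO₃(ℂ)`. -/
lemma conj_mem (g : SL2C) : conj g ∈ Matrix.specialOrthogonalGroup (Fin 3) ℂ := by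
  rw [Matrix.mem_specialOrthogonalGroup_iff, Matrix.mem_orthogonalGroup_iff]
  constructor
  · change conjMatrix g * (conjMatrix g).transpose = 1
    rw [← conjMatrix_inv, ← conjMatrix_mul, mul_inv_cancel, conjMatrix_one]
  · change (conjMatrix g).det = 1
    have hI := Complex.I_sq
    have hdet := sl2_det g
    have h3 : (g 0 0 * g 1 1 - g 0 1 * g 1 0) ^ 3 = 1 := by rw [hdet, one_pow]
    rw [conjMatrix_eq, Matrix.det_fin_three]
    simp only [Matrix.of_apply, Matrix.cons_val', Matrix.cons_val_zero, Matrix.cons_val_one,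
      Matrix.cons_val]
    refine Eq.trans ?_ h3
    ring_nf
    simp only [hI]
    ring_nf

/-- `SO₃(ℤ[i])`: the elements of `SO₃(ℂ)` all of whose entries are Gaussian integers. -/
def SO3Zi : Submonoid (Matrix (Fin 3) (Fin 3) ℂ) where
  carrier := {M | M ∈ Matrix.specialOrthogonalGroup (Fin 3) ℂ ∧
    ∀ i j, M i j ∈ GaussianInt.toComplex.range}
  one_mem' := ⟨one_mem _, fun i j => by
    rw [Matrix.one_apply]
    split_ifs
    · exact one_mem _
    · exact zero_mem _⟩
  mul_mem' := fun {A B} hA hB => ⟨mul_mem hA.1 hB.1, fun i j => by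
    rw [Matrix.mul_apply]
    exact sum_mem fun k _ => mul_mem (hA.2 i k) (hB.2 k j)⟩

/-- `Γ = conj⁻¹(SO₃(ℤ[i]))`, a subgroup of `SL₂(ℂ)`. -/
noncomputable def Gam : Subgroup SL2C where
  carrier := {g | conj g ∈ SO3Zi}
  one_mem' := by
    change conj 1 ∈ SO3Zi
    rw [map_one]
    exact one_mem _
  mul_mem' := fun {a b} ha hb => by
    change conj (a * b) ∈ SO3Zi
    rw [map_mul]
    exact mul_mem ha hb
  inv_mem' := fun {a} ha => ⟨conj_mem a⁻¹, fun i j => by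
    change conjMatrix a⁻¹ i j ∈ _
    rw [conjMatrix_inv]
    exact ha.2 j i⟩

lemma pmOne_le_stab1 : pmOne ≤ stab1 Gam := by
  rintro g hg
  refine ⟨?_, fun z => by rw [pmOne_smul hg]⟩
  rcases hg with rfl | rfl
  · exact Gam.one_mem
  · change conj (-1) ∈ SO3Zi
    have h : conj (-1) = 1 := by
      rw [← map_one conj]
      change conjMatrix (-1) = conjMatrix 1
      rw [conjMatrix_eq, conjMatrix_eq]
      simp
    rw [h]
    exact one_mem _

/-! ### The Grenier domain -/

/-- `𝓕₁ = {z | φ₁(z) ≤ φ₁(γ z) for all γ ∈ Γ}`. -/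
def F1 : Set H3 := {z | ∀ γ ∈ Gam, phi1 z ≤ phi1 (γ • z)}

/-- `𝓕(𝓖) = φ_{[2,3]}⁻¹(𝓖) ∩ 𝓕₁`. -/
def FG (G : Set (ℝ × ℝ)) : Set H3 := phi23 ⁻¹' G ∩ F1

end GrenierDomain

/-!
The height of `γ • z` is the height of `z` divided by `|c x + d|² + |c|² y²`, where `(c, d)` is the
bottom row of `γ` and `z = x + y j` (`normSq_den_eq_rowNormSq`). Comparing `φ₁ (γ • z)` with `φ₁ z`
thus means comparing this quantity with `1`, and everything rests on two arithmetic facts about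
`Γ`.

* The numbers `2 c²` and `2 d²` are Gaussian integers (`two_mul_sq_lower_mem`). Hence only finitely
  many bottom rows satisfy `|c x + d|² + |c|² y² ≤ 1` at some point of a region where `x` is bounded
  and `y` is bounded below (`finite_bottomRow`). So every orbit has a highest point, which lies in
  `𝓕₁`, and the region where `φ₁` is strictly smallest is open.
* An element of `Γ` lies in `Γ^{φ₁}` exactly when `c = 0` (`mem_stab1_iff`): then `a²` and `d²` are
  Gaussian integers with product `1`, so `|d| = 1`.

If `c ≠ 0`, the quantity `|c x + d|² + |c|² y²` is strictly increasing in `y`. Lowering a point at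
which some `γ` outside `Γ^{φ₁}` gives equality leaves `𝓕₁`, which identifies the interior of `𝓕₁`;
raising any point of `𝓕₁` enters this interior without changing `x`, which yields the closure
statement. Finally, if `z` and `γ • z` both lie in the domain with `γ ≠ ±1`, then either `γ` lies
in `Γ^{φ₁}` and `φ_{[2,3]}(z)` is on the boundary of `𝓖`, or the heights of `z` and `γ • z` agree and
`z` is not interior to `𝓕₁`.
-/

namespace GrenierDomain

open Set Filter Topology

/-! ### Fundamental domains -/

lemma IsFundDomain.mem_frontier {G X : Type*} [Group G] [TopologicalSpace X] [MulAction G X]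
    {F : Set X} (hF : IsFundDomain G F) {g : G} (hg : g ≠ 1) {x : X} (hx : x ∈ F)
    (hgx : g • x ∈ F) : x ∈ frontier F := by
  have h := hF.inter 1 g⁻¹ (fun h => hg (inv_eq_one.mp h.symm)) (a := x)
    ⟨by rwa [one_smul], mem_smul_set_iff_inv_smul_mem.mpr (by rwa [inv_inv])⟩
  simpa using h.1

lemma IsFundDomain.of_forall_exists {G X : Type*} [Group G] [TopologicalSpace X] [MulAction G X]
    {F : Set X} (hcover : ∀ x : X, ∃ g : G, g • x ∈ F)
    (hinter : ∀ g : G, g ≠ 1 → ∀ x ∈ F, g • x ∈ F → x ∈ frontier F) : IsFundDomain G F where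
  cover := eq_univ_of_forall fun x => by
    obtain ⟨g, hg⟩ := hcover x
    exact mem_iUnion.mpr ⟨g⁻¹, mem_smul_set_iff_inv_smul_mem.mpr (by rwa [inv_inv])⟩
  inter := by
    have key : ∀ g₁ g₂ : G, g₁ ≠ g₂ → (g₁ • F) ∩ (g₂ • F) ⊆ g₁ • frontier F := by
      rintro g₁ g₂ hne x ⟨h₁, h₂⟩
      rw [mem_smul_set_iff_inv_smul_mem] at h₁ h₂ ⊢
      refine hinter (g₂⁻¹ * g₁) (fun h => hne (inv_mul_eq_one.mp h).symm) _ h₁ ?_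
      rwa [mul_smul, smul_inv_smul]
    exact fun g₁ g₂ hne x hx => ⟨key g₁ g₂ hne hx, key g₂ g₁ hne.symm hx.symm⟩

/-! ### Heights under fractional linear transformations -/

/-- The complex number `x₁ + x₂ i` underlying the point `x₁ + x₂ i + y j`. -/
noncomputable def base (z : H3) : ℂ := z.1.re + z.1.imI * Complex.I

/-- The bottom row `(c, d)` of a matrix. -/
def bottomRow (g : SL2C) : ℂ × ℂ := (g 1 0, g 1 1)

/-- The quantity `|c x + d|² + |c|² y²` attached to a row `(c, d)` and a point `x + y j`. -/
noncomputable def rowNormSq (r : ℂ × ℂ) (z : H3) : ℝ :=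
  ‖r.1 * base z + r.2‖ ^ 2 + ‖r.1‖ ^ 2 * z.1.imJ ^ 2

lemma normSq_den_eq_rowNormSq (g : SL2C) (z : H3) :
    Quaternion.normSq (den g z.1) = rowNormSq (bottomRow g) z := by
  have hk := z.2.2
  simp only [rowNormSq, ← Complex.normSq_eq_norm_sq]
  simp [Quaternion.normSq_def', den, bottomRow, base, Complex.normSq_apply, hk]
  ring

lemma rowNormSq_pos (g : SL2C) (z : H3) : 0 < rowNormSq (bottomRow g) z := by
  rw [← normSq_den_eq_rowNormSq]
  exact lt_of_le_of_ne Quaternion.normSq_nonneg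
    (Quaternion.normSq_ne_zero.mpr (den_ne_zero g z)).symm

lemma phi1_smul (g : SL2C) (z : H3) :
    phi1 (g • z) = phi1 z + Real.log (rowNormSq (bottomRow g) z) := by
  rw [phi1, phi1, imJ_smul, normSq_den_eq_rowNormSq,
    Real.log_div z.2.1.ne' (rowNormSq_pos g z).ne']
  ring

lemma phi1_le_phi1_smul_iff (g : SL2C) (z : H3) :
    phi1 z ≤ phi1 (g • z) ↔ 1 ≤ rowNormSq (bottomRow g) z := by
  rw [phi1_smul, le_add_iff_nonneg_right, Real.log_nonneg_iff (rowNormSq_pos g z)]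

lemma phi1_lt_phi1_smul_iff (g : SL2C) (z : H3) :
    phi1 z < phi1 (g • z) ↔ 1 < rowNormSq (bottomRow g) z := by
  rw [phi1_smul, lt_add_iff_pos_right, Real.log_pos_iff (rowNormSq_pos g z).le]

lemma continuous_imJ : Continuous fun z : H3 => z.1.imJ :=
  Quaternion.continuous_imJ.comp continuous_subtype_val

lemma continuous_base : Continuous base := by
  have h1 : Continuous fun z : H3 => z.1.re :=
    Quaternion.continuous_re.comp continuous_subtype_val
  have h2 : Continuous fun z : H3 => z.1.imI :=
    Quaternion.continuous_imI.comp continuous_subtype_val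
  unfold base
  fun_prop

lemma continuous_rowNormSq (r : ℂ × ℂ) : Continuous (rowNormSq r) := by
  have h1 := continuous_imJ
  have h2 := continuous_base
  unfold rowNormSq
  fun_prop

/-! ### Horizontal and vertical coordinates -/

/-- The point `t₁ + t₂ i + y j`. -/
def pointAt (t : ℝ × ℝ) (y : ℝ) (hy : 0 < y) : H3 := ⟨⟨t.1, t.2, y, 0⟩, hy, rfl⟩

lemma pointAt_phi23 (z : H3) : pointAt (phi23 z) z.1.imJ z.2.1 = z :=
  Subtype.ext (QuaternionAlgebra.ext rfl rfl rfl z.2.2.symm)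

lemma continuous_quaternion_mk :
    Continuous (Y := ℍ[ℝ]) fun p : (ℝ × ℝ) × ℝ => ⟨p.1.1, p.1.2, p.2, 0⟩ := by
  let e₁ : ℍ[ℝ] := ⟨1, 0, 0, 0⟩
  let e₂ : ℍ[ℝ] := ⟨0, 1, 0, 0⟩
  let e₃ : ℍ[ℝ] := ⟨0, 0, 1, 0⟩
  have h : Continuous fun p : (ℝ × ℝ) × ℝ => p.1.1 • e₁ + p.1.2 • e₂ + p.2 • e₃ := by
    fun_prop
  refine h.congr fun p => ?_
  ext <;> simp <;> simp [e₁, e₂, e₃]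

lemma continuous_phi23 : Continuous phi23 :=
  (Quaternion.continuous_re.comp continuous_subtype_val).prodMk
    (Quaternion.continuous_imI.comp continuous_subtype_val)

lemma isOpenMap_phi23 : IsOpenMap phi23 :=
  IsOpenMap.of_sections fun z => ⟨fun t => pointAt t z.1.imJ z.2.1,
    ((continuous_quaternion_mk.comp (by fun_prop : Continuous fun t : ℝ × ℝ =>
      (t, z.1.imJ))).subtype_mk _).continuousAt, pointAt_phi23 z, fun _ => rfl⟩

/-- The point obtained from `z` by multiplying its height by `eˢ`. -/
noncomputable def raise (z : H3) (s : ℝ) : H3 :=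
  pointAt (phi23 z) (Real.exp s * z.1.imJ) (mul_pos (Real.exp_pos s) z.2.1)

lemma phi23_raise (z : H3) (s : ℝ) : phi23 (raise z s) = phi23 z := rfl

lemma raise_zero (z : H3) : raise z 0 = z := by
  simp only [raise, Real.exp_zero, one_mul, pointAt_phi23]

lemma continuous_raise (z : H3) : Continuous (raise z) :=
  (continuous_quaternion_mk.comp (by fun_prop : Continuous fun s : ℝ =>
    (phi23 z, Real.exp s * z.1.imJ))).subtype_mk _

lemma tendsto_raise (z : H3) (S : Set ℝ) : Tendsto (raise z) (𝓝[S] 0) (𝓝 z) := by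
  have h := (continuous_raise z).tendsto 0
  rw [raise_zero] at h
  exact h.mono_left nhdsWithin_le_nhds

lemma rowNormSq_raise_strictMono {r : ℂ × ℂ} (hr : r.1 ≠ 0) (z : H3) :
    StrictMono fun s => rowNormSq r (raise z s) := by
  intro s t hst
  have hy := z.2.1
  change ‖r.1 * base z + r.2‖ ^ 2 + ‖r.1‖ ^ 2 * (Real.exp s * z.1.imJ) ^ 2
    < ‖r.1 * base z + r.2‖ ^ 2 + ‖r.1‖ ^ 2 * (Real.exp t * z.1.imJ) ^ 2
  have hexp := Real.exp_lt_exp.mpr hst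
  gcongr

/-! ### Arithmetic of `Γ` -/

lemma mul_I_mem {w : ℂ} (hw : w ∈ GaussianInt.toComplex.range) :
    Complex.I * w ∈ GaussianInt.toComplex.range :=
  mul_mem ⟨⟨0, 1⟩, by simp [GaussianInt.toComplex_def]⟩ hw

/-- Linear combinations of the four upper left entries of `conj γ` over `ℤ[i]` isolate the squares
of the entries of `γ`. -/
lemma two_mul_sq_lower_mem {γ : SL2C} (hγ : γ ∈ Gam) :
    2 * (γ 1 0) ^ 2 ∈ GaussianInt.toComplex.range ∧
      2 * (γ 1 1) ^ 2 ∈ GaussianInt.toComplex.range := by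
  have h : ∀ i j, conjMatrix γ i j ∈ GaussianInt.toComplex.range := hγ.2
  have h00 := h 0 0
  have h01 := mul_I_mem (h 0 1)
  have h10 := mul_I_mem (h 1 0)
  have h11 := h 1 1
  rw [conjMatrix_eq] at h00 h01 h10 h11
  simp only [Matrix.of_apply, Matrix.cons_val', Matrix.cons_val_zero, Matrix.cons_val_one]
    at h00 h01 h10 h11
  have hI := Complex.I_sq
  constructor
  · convert add_mem (add_mem (sub_mem h11 h00) h01) h10 using 1
    linear_combination (γ 1 0 ^ 2 - γ 0 1 ^ 2) * hI
  · convert sub_mem (add_mem (add_mem h11 h00) h01) h10 using 1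
    linear_combination (γ 1 1 ^ 2 - γ 0 0 ^ 2) * hI

lemma norm_lower_right_eq_one {γ : SL2C} (hγ : γ ∈ Gam) (hc : γ 1 0 = 0) : ‖γ 1 1‖ = 1 := by
  have h : ∀ i j, conjMatrix γ i j ∈ GaussianInt.toComplex.range := hγ.2
  have hI := Complex.I_sq
  have ha : (γ 0 0) ^ 2 ∈ GaussianInt.toComplex.range := by
    have h00 := h 0 0
    have h01 := mul_I_mem (h 0 1)
    rw [conjMatrix_eq] at h00 h01
    simp only [Matrix.of_apply, Matrix.cons_val', Matrix.cons_val_zero, Matrix.cons_val_one]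
      at h00 h01
    convert sub_mem h00 h01 using 1
    rw [hc]
    linear_combination (γ 0 0 ^ 2 + γ 0 1 ^ 2 - γ 1 1 ^ 2) / 2 * hI
  have hd : (γ 1 1) ^ 2 ∈ GaussianInt.toComplex.range := by
    have h00 := h 0 0
    have h10 := mul_I_mem (h 1 0)
    rw [conjMatrix_eq] at h00 h10
    simp only [Matrix.of_apply, Matrix.cons_val', Matrix.cons_val_zero, Matrix.cons_val_one]
      at h00 h10
    convert sub_mem h00 h10 using 1
    rw [hc]
    linear_combination (γ 0 1 ^ 2 + γ 1 1 ^ 2 - γ 0 0 ^ 2) / 2 * hI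
  obtain ⟨p, hp⟩ := ha
  obtain ⟨q, hq⟩ := hd
  have hdet := sl2_det γ
  rw [hc, mul_zero, sub_zero] at hdet
  have hqp : q * p = 1 := by
    apply GaussianInt.toComplex_inj.mp
    rw [map_mul, hp, hq, map_one]
    linear_combination (γ 0 0 * γ 1 1 + 1) * hdet
  have hnorm := Zsqrtd.norm_eq_one_iff.mpr (IsUnit.of_mul_eq_one p hqp)
  have hnorm' : q.norm = 1 := by rw [← GaussianInt.abs_natCast_norm, hnorm, Nat.cast_one]
  have hreal := GaussianInt.intCast_real_norm q
  rw [hnorm', hq, Complex.normSq_eq_norm_sq, norm_pow, Int.cast_one, ← pow_mul] at hreal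
  exact (pow_eq_one_iff_of_nonneg (norm_nonneg _) (by norm_num)).mp hreal.symm

lemma mem_stab1_iff {γ : SL2C} (hγ : γ ∈ Gam) : γ ∈ stab1 Gam ↔ γ 1 0 = 0 := by
  refine ⟨lower_left_of_mem, fun hc => ⟨hγ, fun z => ?_⟩⟩
  have h1 : rowNormSq (bottomRow γ) z = 1 := by
    simp [rowNormSq, bottomRow, hc, norm_lower_right_eq_one hγ hc]
  rw [phi1_smul, h1, Real.log_one, add_zero]

/-! ### Local finiteness -/

lemma finite_gaussianInt_norm_le (R : ℝ) :
    {w : ℂ | w ∈ GaussianInt.toComplex.range ∧ ‖w‖ ≤ R}.Finite := by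
  refine (((finite_Icc (-⌈R⌉) ⌈R⌉).prod (finite_Icc (-⌈R⌉) ⌈R⌉)).image
    fun p : ℤ × ℤ => GaussianInt.toComplex ⟨p.1, p.2⟩).subset ?_
  rintro _ ⟨⟨p, rfl⟩, hR⟩
  have bound : ∀ n : ℤ, |(n : ℝ)| ≤ R → n ∈ Icc (-⌈R⌉) ⌈R⌉ := fun n hn => by
    rw [mem_Icc, ← abs_le]
    exact_mod_cast (show ((|n| : ℤ) : ℝ) ≤ ⌈R⌉ by
      rw [Int.cast_abs]; exact hn.trans (Int.le_ceil R))
  refine ⟨(p.re, p.im), ⟨bound _ ?_, bound _ ?_⟩, rfl⟩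
  · simpa using (Complex.abs_re_le_norm _).trans hR
  · simpa using (Complex.abs_im_le_norm _).trans hR

lemma finite_two_mul_sq_gaussianInt (R : ℝ) :
    {w : ℂ | 2 * w ^ 2 ∈ GaussianInt.toComplex.range ∧ ‖w‖ ≤ R}.Finite := by
  refine ((finite_gaussianInt_norm_le (2 * R ^ 2)).preimage'
    (f := fun w : ℂ => 2 * w ^ 2) fun v _ => ?_).subset ?_
  · rcases ((fun w : ℂ => 2 * w ^ 2) ⁻¹' {v}).eq_empty_or_nonempty with h | ⟨u, hu⟩
    · rw [h]
      exact finite_empty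
    · refine (toFinite {u, -u}).subset fun w hw => ?_
      have h : w ^ 2 = u ^ 2 := mul_left_cancel₀ two_ne_zero (Eq.trans hw (Eq.symm hu))
      exact sq_eq_sq_iff_eq_or_eq_neg.mp h
  · rintro w ⟨hw, hR⟩
    refine ⟨hw, ?_⟩
    rw [norm_mul, norm_pow, Complex.norm_ofNat]
    gcongr

lemma finite_bottomRow {δ : ℝ} (hδ : 0 < δ) (R : ℝ) :
    {r : ℂ × ℂ | r ∈ bottomRow '' (Gam : Set SL2C) ∧
      ∃ z : H3, δ ≤ z.1.imJ ∧ ‖base z‖ ≤ R ∧ rowNormSq r z ≤ 1}.Finite := by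
  refine ((finite_two_mul_sq_gaussianInt (1 / δ)).prod
    (finite_two_mul_sq_gaussianInt (1 + 1 / δ * R))).subset ?_
  rintro _ ⟨⟨γ, hγ, rfl⟩, z, hz, hR, h⟩
  obtain ⟨hc, hd⟩ := two_mul_sq_lower_mem hγ
  rw [rowNormSq] at h
  change ‖γ 1 0 * base z + γ 1 1‖ ^ 2 + ‖γ 1 0‖ ^ 2 * z.1.imJ ^ 2 ≤ 1 at h
  have hc' : ‖γ 1 0‖ ≤ 1 / δ := by
    rw [le_div_iff₀ hδ]
    refine (mul_le_mul_of_nonneg_left hz (norm_nonneg _)).trans ?_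
    refine (abs_le_one_iff_mul_self_le_one.mpr ?_ |> (le_abs_self _).trans)
    nlinarith [sq_nonneg ‖γ 1 0 * base z + γ 1 1‖]
  have hs : ‖γ 1 0 * base z + γ 1 1‖ ≤ 1 := by
    refine (abs_le_one_iff_mul_self_le_one.mpr ?_ |> (le_abs_self _).trans)
    nlinarith [sq_nonneg (‖γ 1 0‖ * z.1.imJ)]
  refine ⟨⟨hc, hc'⟩, hd, ?_⟩
  calc ‖γ 1 1‖ = ‖(γ 1 0 * base z + γ 1 1) - γ 1 0 * base z‖ := by rw [add_sub_cancel_left]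
    _ ≤ ‖γ 1 0 * base z + γ 1 1‖ + ‖γ 1 0‖ * ‖base z‖ := by
      rw [← norm_mul]; exact norm_sub_le _ _
    _ ≤ 1 + 1 / δ * R := by gcongr

/-- Every orbit of `Γ` has a highest point. -/
lemma exists_smul_mem_F1 (z : H3) : ∃ γ ∈ Gam, γ • z ∈ F1 := by
  have hone : rowNormSq (bottomRow 1) z = 1 := by simp [rowNormSq, bottomRow]
  obtain ⟨_, ⟨⟨γ, hγ, rfl⟩, hγz⟩, hmin⟩ := exists_min_image
    {r : ℂ × ℂ | r ∈ bottomRow '' (Gam : Set SL2C) ∧ rowNormSq r z ≤ 1} (fun r => rowNormSq r z)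
    ((finite_bottomRow z.2.1 ‖base z‖).subset fun r hr => ⟨hr.1, z, le_rfl, le_rfl, hr.2⟩)
    ⟨bottomRow 1, ⟨1, Gam.one_mem, rfl⟩, hone.le⟩
  refine ⟨γ, hγ, fun δ hδ => ?_⟩
  rw [← mul_smul, phi1_smul, phi1_smul]
  gcongr
  · exact rowNormSq_pos γ z
  · rcases le_total (rowNormSq (bottomRow (δ * γ)) z) 1 with h | h
    · exact hmin _ ⟨⟨δ * γ, Gam.mul_mem hδ hγ, rfl⟩, h⟩
    · exact hγz.trans h

/-! ### The domain `𝓕₁` -/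

/-- The points at which `φ₁` is strictly smaller than at all translates by elements of `Γ` outside
`Γ^{φ₁}`. -/
def strictF1 : Set H3 := {z | ∀ γ ∈ Gam, γ ∉ stab1 Gam → phi1 z < phi1 (γ • z)}

lemma strictF1_subset_F1 : strictF1 ⊆ F1 := by
  intro z hz γ hγ
  by_cases h : γ ∈ stab1 Gam
  · exact (h.2 z).ge
  · exact (hz γ hγ h).le

lemma isOpen_strictF1 : IsOpen strictF1 := by
  rw [isOpen_iff_mem_nhds]
  intro z hz
  set S := {r : ℂ × ℂ | r ∈ bottomRow '' (Gam : Set SL2C) ∧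
      ∃ w : H3, z.1.imJ / 2 ≤ w.1.imJ ∧ ‖base w‖ ≤ ‖base z‖ + 1 ∧ rowNormSq r w ≤ 1} with hS
  have hfin : S.Finite := finite_bottomRow (half_pos z.2.1) _
  -- Near `z` only the finitely many rows in `S` can fail the strict inequality.
  have hrows : ∀ᶠ w in 𝓝 z, ∀ r ∈ S, r.1 ≠ 0 → 1 < rowNormSq r w := by
    refine (eventually_all_finite hfin).mpr ?_
    rintro _ ⟨⟨γ, hγ, rfl⟩, -⟩
    refine eventually_imp_distrib_left.mpr fun hc => ?_
    exact (continuous_rowNormSq _).continuousAt.eventually (lt_mem_nhds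
      ((phi1_lt_phi1_smul_iff γ z).mp (hz γ hγ fun h => hc (lower_left_of_mem h))))
  filter_upwards [hrows, continuous_imJ.continuousAt.eventually
    (le_mem_nhds (half_lt_self z.2.1)), continuous_base.norm.continuousAt.eventually
    (ge_mem_nhds (lt_add_one ‖base z‖))] with w hw hJ hb γ hγ hstab
  rw [phi1_lt_phi1_smul_iff]
  by_contra! h
  exact h.not_gt (hw _ ⟨⟨γ, hγ, rfl⟩, w, hJ, hb, h⟩ fun hc => hstab ((mem_stab1_iff hγ).mpr hc))

lemma raise_mem_strictF1 {z : H3} (hz : z ∈ F1) {s : ℝ} (hs : 0 < s) : raise z s ∈ strictF1 := by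
  intro γ hγ hstab
  have hc : (bottomRow γ).1 ≠ 0 := fun hc => hstab ((mem_stab1_iff hγ).mpr hc)
  have hlt := rowNormSq_raise_strictMono hc z hs
  simp only [raise_zero] at hlt
  exact (phi1_lt_phi1_smul_iff _ _).mpr (((phi1_le_phi1_smul_iff γ z).mp (hz γ hγ)).trans_lt hlt)

lemma interior_F1 : interior F1 = strictF1 := by
  refine Subset.antisymm (fun z hz γ hγ hstab => ?_)
    (interior_maximal strictF1_subset_F1 isOpen_strictF1)
  have hc : (bottomRow γ).1 ≠ 0 := fun hc => hstab ((mem_stab1_iff hγ).mpr hc)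
  -- A point slightly below `z` is still in `𝓕₁`.
  obtain ⟨s, hsF, hs⟩ := (((tendsto_raise z (Iio 0)).eventually
    (mem_interior_iff_mem_nhds.mp hz)).and self_mem_nhdsWithin).exists
  have hlt := rowNormSq_raise_strictMono hc z hs
  simp only [raise_zero] at hlt
  exact (phi1_lt_phi1_smul_iff γ z).mpr
    (((phi1_le_phi1_smul_iff γ _).mp (hsF γ hγ)).trans_lt hlt)

lemma isClosed_F1 : IsClosed F1 := by
  simp only [F1, phi1_le_phi1_smul_iff, ofPred_forall]
  exact isClosed_iInter fun γ => isClosed_iInter fun _ =>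
    isClosed_le continuous_const (continuous_rowNormSq _)

lemma smul_mem_F1_of_mem_stab1 {δ : SL2C} (hδ : δ ∈ stab1 Gam) {z : H3} (hz : z ∈ F1) :
    δ • z ∈ F1 := by
  intro γ hγ
  rw [hδ.2, ← mul_smul]
  exact hz _ (Gam.mul_mem hγ hδ.1)

/-! ### The domain `𝓕(𝓖)` -/

lemma interior_FG (G : Set (ℝ × ℝ)) : interior (FG G) = phi23 ⁻¹' interior G ∩ interior F1 := by
  rw [FG, interior_inter,
    isOpenMap_phi23.preimage_interior_eq_interior_preimage continuous_phi23]

lemma FG_eq_closure_interior {G : Set (ℝ × ℝ)} (hG : G = closure (interior G)) :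
    FG G = closure (interior (FG G)) := by
  refine Subset.antisymm (fun z hz => ?_) (closure_minimal interior_subset ?_)
  · refine isClosed_closure.mem_of_tendsto (tendsto_raise z (Ioi 0)) ?_
    filter_upwards [self_mem_nhdsWithin] with s hs
    have hmem : raise z s ∈ strictF1 ∩ closure (phi23 ⁻¹' interior G) := by
      refine ⟨raise_mem_strictF1 hz.2 hs, ?_⟩
      rw [← isOpenMap_phi23.preimage_closure_eq_closure_preimage continuous_phi23, ← hG]
      exact hz.1
    rw [interior_FG, interior_F1, inter_comm]
    exact isOpen_strictF1.inter_closure hmem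
  · have hGc : IsClosed G := hG ▸ isClosed_closure
    exact (hGc.preimage continuous_phi23).inter isClosed_F1

lemma isFundDomain_FG {G : Set (ℝ × ℝ)} (hG : IsFundDomain (ModPM (stab1 Gam)) G) :
    IsFundDomain (ModPM Gam) (FG G) := by
  refine IsFundDomain.of_forall_exists (fun z => ?_) fun g => ?_
  · obtain ⟨γ, hγ, hF⟩ := exists_smul_mem_F1 z
    obtain ⟨g, hg⟩ := mem_iUnion.mp (hG.cover.ge (mem_univ (phi23 (γ • z))))
    rw [mem_smul_set_iff_inv_smul_mem] at hg
    obtain ⟨δ, hδ⟩ := QuotientGroup.mk_surjective g⁻¹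
    rw [← hδ, mk_smul_prod, phi23_smul_congr δ.2 (phi23_sigma23 _)] at hg
    refine ⟨QuotientGroup.mk ⟨δ * γ, Gam.mul_mem δ.2.1 hγ⟩, ?_⟩
    rw [mk_smul_H3, mul_smul]
    exact ⟨hg, smul_mem_F1_of_mem_stab1 δ.2 hF⟩
  · obtain ⟨γ, rfl⟩ := QuotientGroup.mk_surjective g
    intro hne z hz hγz
    rw [mk_smul_H3] at hγz
    refine ⟨subset_closure hz, fun hint => ?_⟩
    rw [interior_FG, interior_F1] at hint
    by_cases hstab : (γ : SL2C) ∈ stab1 Gam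
    · have hne' : (QuotientGroup.mk ⟨γ, hstab⟩ : ModPM (stab1 Gam)) ≠ 1 := fun h =>
        hne ((QuotientGroup.eq_one_iff γ).mpr (show (γ : SL2C) ∈ pmOne from
          (QuotientGroup.eq_one_iff (N := pmOne.subgroupOf (stab1 Gam)) _).mp h))
      refine (hG.mem_frontier hne' hz.1 ?_).2 hint.1
      rw [mk_smul_prod, phi23_smul_congr hstab (phi23_sigma23 _)]
      exact hγz.1
    · have h := hγz.2 _ (Gam.inv_mem γ.2)
      rw [inv_smul_smul] at h
      exact h.not_gt (hint.2 γ γ.2 hstab)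

end GrenierDomain

theorem mainTheorem2 (G : Set (ℝ × ℝ))
    (hG : GrenierDomain.IsFundDomain (GrenierDomain.ModPM (GrenierDomain.stab1 GrenierDomain.Gam)) G)
    (hGcl : G = closure (interior G)) :
    GrenierDomain.IsFundDomain (GrenierDomain.ModPM GrenierDomain.Gam) (GrenierDomain.FG G) ∧
    GrenierDomain.FG G = closure (interior (GrenierDomain.FG G)) ∧
    interior GrenierDomain.F1 =
      {z : GrenierDomain.H3 | ∀ γ ∈ GrenierDomain.Gam, γ ∉ GrenierDomain.stab1 GrenierDomain.Gam →
        GrenierDomain.phi1 z < GrenierDomain.phi1 (γ • z)} ∧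
    interior (GrenierDomain.FG G) =
      GrenierDomain.phi23 ⁻¹' interior G ∩ interior GrenierDomain.F1 := by
  exact ⟨GrenierDomain.isFundDomain_FG hG, GrenierDomain.FG_eq_closure_interior hGcl,
    GrenierDomain.interior_F1, GrenierDomain.interior_FG G⟩
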